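/- There exist absolute constants $C>0$ and $K>0$ such that the following holds. Let $0<\nu\le 1$, let $\gamma,\lambda,\alpha,\alpha_0\in\mathbb R$ with $|\gamma|\ge K\nu^2$ and $|\alpha|>1$, and let $w\in H^2(\mathbb T_{2\pi};\mathbb C)$, where $\mathbb T_{2\pi}=\mathbb R/2\pi\mathbb Z$. Let $\varphi\in H^2(\mathbb T_{2\pi};\mathbb C)$ be the solution of $(\partial_y^2-\alpha^2)\varphi=w$ and put $$L_\lambda w=i\frac{\gamma}{\nu}\big[(\sin(y+\alpha_0)-\lambda)\,w+\sin(y+\alpha_0)\,\varphi\big]-\nu\,\partial_y^2 w .$$ Then $$\|L_\lambda w\|_{L^2(\mathbb T_{2\pi})}\ \ge\ C\,|\gamma|^{1/2}\,(1-\alpha^{-2})\,\|w\|_{L^2(\mathbb T_{2\pi})}.$$ In particular $C$ and $K$ do not depend on $\nu,\gamma,\lambda,\alpha,\alpha_0$ or $w$. -/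

import Mathlib

open Real MeasureTheory
open scoped ContDiff

noncomputable section

namespace HelicalFlow

/-- Lebesgue measure on one period `(0, 2π]`. -/
def periodMeasure : Measure ℝ := volume.restrict (Set.Ioc 0 (2 * π))

/-- `f` represents an element of `L²(𝕋_{2π}; ℂ)`: a `2π`-periodic function on the line that is
square integrable over one period. -/
def IsL2 (f : ℝ → ℂ) : Prop :=
  Function.Periodic f (2 * π) ∧ MemLp f 2 periodMeasure

/-- The norm of `L²(𝕋_{2π}; ℂ)`; it is a genuine (finite) norm on functions with `IsL2 f`. -/
def l2Norm (f : ℝ → ℂ) : ℝ := (eLpNorm f 2 periodMeasure).toReal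

/-- `g ∈ L²` is the weak derivative on the torus `𝕋_{2π}` of `f ∈ L²`, tested against all smooth
`2π`-periodic functions. -/
def HasWeakDeriv (f g : ℝ → ℂ) : Prop :=
  IsL2 f ∧ IsL2 g ∧
    ∀ ψ : ℝ → ℂ, ContDiff ℝ ∞ ψ → Function.Periodic ψ (2 * π) →
      ∫ y in (0 : ℝ)..(2 * π), f y * deriv ψ y = -∫ y in (0 : ℝ)..(2 * π), g y * ψ y

/-- `f ∈ H²(𝕋_{2π}; ℂ)`, with weak second derivative `f₂`. -/
def HasWeakSecondDeriv (f f₂ : ℝ → ℂ) : Prop :=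
  ∃ f₁ : ℝ → ℂ, HasWeakDeriv f f₁ ∧ HasWeakDeriv f₁ f₂

/-- `φ ∈ H²(𝕋_{2π}; ℂ)` solves `(∂_y² - α²) φ = w`. -/
def IsStreamFunction (α : ℝ) (w φ : ℝ → ℂ) : Prop :=
  ∃ φ₂ : ℝ → ℂ, HasWeakSecondDeriv φ φ₂ ∧
    ∀ᵐ y ∂periodMeasure, φ₂ y - (α : ℂ) ^ 2 * φ y = w y

/-- The expression
`i (γ/ν) [(sin (y + α₀) - lam) w + sin (y + α₀) φ] - ν w₂`, where `w₂` stands for `∂_y² w`. -/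
def resolventExpr (ν γ lam α₀ : ℝ) (w φ w₂ : ℝ → ℂ) : ℝ → ℂ := fun y =>
  Complex.I * ((γ / ν : ℝ) : ℂ) *
      (((Real.sin (y + α₀) - lam : ℝ) : ℂ) * w y + ((Real.sin (y + α₀) : ℝ) : ℂ) * φ y)
    - (ν : ℂ) * w₂ y

/-- `f = L_lam w`: the operator `L_lam` with domain `H²(𝕋_{2π}; ℂ)`, as a graph. -/
def IsResolventImage (ν γ lam α α₀ : ℝ) (w f : ℝ → ℂ) : Prop :=
  ∃ w₂ φ : ℝ → ℂ, HasWeakSecondDeriv w w₂ ∧ IsStreamFunction α w φ ∧ IsL2 f ∧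
    ∀ᵐ y ∂periodMeasure, f y = resolventExpr ν γ lam α₀ w φ w₂ y

end HelicalFlow

end

namespace HelicalFlow

open ComplexConjugate

/-! ### Square integrable periodic functions -/

/-! With `g = w + φ`, `b = α² - 1` and `A = γ/ν²` one has `φ'' = g + bφ`, and `L_λ w / ν` becomes `F
= iA·S - (g'' - φ'')` with `S = (sin - λ)g + λφ`. The Helmholtz relation gives `(1 - α⁻²)‖w‖ ≤ ‖g‖`
(`l2Norm_le_of_helmholtz`), so it is enough to prove `‖F‖ ≳ s‖g‖` with `s = |A|^(1/2)`
(`l2Norm_resolvent_ge`). A translation by `π` flips the signs of `λ` and `A`, so `λ ≥ 0` may be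
assumed.

The dangerous scenario is concentration of `g` at the maximum of `sin`, at the diffusive width
`s^(-1/2)`. It is measured by `Q = ∫ (1 - sin)|g|²`. Pairing `-S` with `2a g' + (2a' + 1)g` controls
`Q` (`neg_reInner_rayleigh_multiplier`): for `a = cos` the weight on `|g|²` is exactly `(1 + λ)(1 -
sin)`. That choice costs a full `‖g'‖`, so `cos` is damped away from the maximum at width `√k`,
where `k = 3(max(1 - λ, 0) + 1/s)`. The weight stays coercive (`truncCos_coercive`) while `|a| ≤
√(2k)`.

Conversely `Q` cannot be small unless `‖g'‖` is large, because `∫ sin |g|² = 2 Re⟨cos g, g'⟩`.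
Pairing `F` with `g` and with `g''` bounds `g'`, `φ''` and `g''`, and hence `S`; pairing `S` with
`g` bounds `1 - λ`. If `‖F‖` were much smaller than `s‖g‖`, these bounds would be incompatible
(`le_of_energy_estimates`). -/

instance : IsFiniteMeasure periodMeasure := by
  unfold periodMeasure; infer_instance

theorem IsL2.add {f g : ℝ → ℂ} (hf : IsL2 f) (hg : IsL2 g) : IsL2 (fun y => f y + g y) :=
  ⟨hf.1.add hg.1, hf.2.add hg.2⟩

theorem IsL2.const_mul {f : ℝ → ℂ} (hf : IsL2 f) (c : ℂ) : IsL2 (fun y => c * f y) :=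
  ⟨fun y => by simp [hf.1 y], hf.2.const_mul c⟩

theorem exists_bound_of_continuous {a : ℝ → ℝ} (ha : Continuous a) :
    ∃ C, ∀ᵐ y ∂periodMeasure, ‖(a y : ℂ)‖ ≤ C := by
  obtain ⟨C, hC⟩ := (isCompact_Icc (a := (0 : ℝ)) (b := 2 * π)).exists_bound_of_continuousOn
    ha.continuousOn
  refine ⟨C, ?_⟩
  unfold periodMeasure
  filter_upwards [ae_restrict_mem measurableSet_Ioc] with y hy
  simpa using hC y (Set.Ioc_subset_Icc_self hy)

theorem memLp_mul_continuous {a : ℝ → ℝ} (ha : Continuous a) {f : ℝ → ℂ}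
    (hf : MemLp f 2 periodMeasure) : MemLp (fun y => (a y : ℂ) * f y) 2 periodMeasure := by
  obtain ⟨C, hC⟩ := exists_bound_of_continuous ha
  have hm : AEStronglyMeasurable (fun y => (a y : ℂ) * f y) periodMeasure :=
    (Complex.continuous_ofReal.comp ha).aestronglyMeasurable.mul hf.1
  refine hf.of_le_mul (c := C) hm ?_
  filter_upwards [hC] with y hy
  rw [norm_mul]
  gcongr

theorem IsL2.mul_continuous {a : ℝ → ℝ} (ha : Continuous a) (hp : Function.Periodic a (2 * π))
    {f : ℝ → ℂ} (hf : IsL2 f) : IsL2 (fun y => (a y : ℂ) * f y) :=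
  ⟨fun y => by simp [hf.1 y, hp y], memLp_mul_continuous ha hf.2⟩

theorem integrable_mul_conj {f g : ℝ → ℂ} (hf : IsL2 f) (hg : IsL2 g) :
    Integrable (fun y => f y * conj (g y)) periodMeasure := by
  have hg' : MemLp (fun y => conj (g y)) 2 periodMeasure := hg.2.star
  exact hf.2.integrable_mul hg'

theorem integrable_re_mul_conj {f g : ℝ → ℂ} (hf : IsL2 f) (hg : IsL2 g) :
    Integrable (fun y => (f y * conj (g y)).re) periodMeasure :=
  (integrable_mul_conj hf hg).re

theorem integrable_weight {a : ℝ → ℝ} (ha : Continuous a) {F : ℝ → ℝ}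
    (hF : Integrable F periodMeasure) : Integrable (fun y => a y * F y) periodMeasure := by
  obtain ⟨C, hC⟩ := exists_bound_of_continuous ha
  refine hF.bdd_mul (c := C) ha.aestronglyMeasurable ?_
  filter_upwards [hC] with y hy
  simpa using hy

theorem integrable_norm_sq {f : ℝ → ℂ} (hf : IsL2 f) :
    Integrable (fun y => ‖f y‖ ^ 2) periodMeasure := by
  simpa using hf.2.integrable_norm_pow (by norm_num)

theorem l2Norm_nonneg (f : ℝ → ℂ) : 0 ≤ l2Norm f := ENNReal.toReal_nonneg

theorem l2Norm_sq {f : ℝ → ℂ} (hf : IsL2 f) :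
    l2Norm f ^ 2 = ∫ y, ‖f y‖ ^ 2 ∂periodMeasure := by
  unfold l2Norm
  rw [hf.2.eLpNorm_eq_integral_rpow_norm (by norm_num) (by norm_num),
    ENNReal.toReal_ofReal (by positivity)]
  have h0 : 0 ≤ ∫ y, ‖f y‖ ^ 2 ∂periodMeasure := by positivity
  simp only [ENNReal.toReal_ofNat, rpow_ofNat]
  rw [← Real.rpow_natCast, ← Real.rpow_mul h0]
  norm_num

theorem l2Norm_add_le {f g : ℝ → ℂ} (hf : IsL2 f) (hg : IsL2 g) :
    l2Norm (fun y => f y + g y) ≤ l2Norm f + l2Norm g := by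
  unfold l2Norm
  rw [← ENNReal.toReal_add hf.2.2.ne hg.2.2.ne]
  exact ENNReal.toReal_mono (ENNReal.add_ne_top.2 ⟨hf.2.2.ne, hg.2.2.ne⟩)
    (eLpNorm_add_le hf.2.1 hg.2.1 (by norm_num))

theorem l2Norm_const_mul (c : ℂ) (f : ℝ → ℂ) : l2Norm (fun y => c * f y) = ‖c‖ * l2Norm f := by
  unfold l2Norm
  have : (fun y => c * f y) = c • f := rfl
  rw [this, eLpNorm_const_smul, ENNReal.toReal_mul]
  simp

theorem l2Norm_congr {f g : ℝ → ℂ} (h : ∀ᵐ y ∂periodMeasure, f y = g y) :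
    l2Norm f = l2Norm g := by
  unfold l2Norm
  rw [eLpNorm_congr_ae h]

theorem l2Norm_mul_le {a : ℝ → ℝ} {f : ℝ → ℂ} {C : ℝ} (hC : ∀ y, |a y| ≤ C)
    (hf : IsL2 f) : l2Norm (fun y => (a y : ℂ) * f y) ≤ C * l2Norm f := by
  have hC0 : 0 ≤ C := (abs_nonneg _).trans (hC 0)
  unfold l2Norm
  rw [← ENNReal.toReal_ofReal hC0, ← ENNReal.toReal_mul]
  refine ENNReal.toReal_mono (ENNReal.mul_ne_top ENNReal.ofReal_ne_top hf.2.2.ne) ?_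
  refine eLpNorm_le_mul_eLpNorm_of_ae_le_mul (Filter.Eventually.of_forall fun y => ?_) 2
  rw [norm_mul, Complex.norm_real]
  gcongr
  exact hC y

/-- The real part of the inner product of `L²(𝕋_{2π}; ℂ)`. -/
noncomputable def reInner (f g : ℝ → ℂ) : ℝ := ∫ y, (f y * conj (g y)).re ∂periodMeasure

theorem reInner_self {f : ℝ → ℂ} (hf : IsL2 f) : reInner f f = l2Norm f ^ 2 := by
  rw [l2Norm_sq hf]
  unfold reInner
  congr 1
  ext y
  rw [Complex.mul_conj, Complex.ofReal_re, Complex.normSq_eq_norm_sq]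

theorem reInner_comm (f g : ℝ → ℂ) : reInner f g = reInner g f := by
  unfold reInner
  congr 1
  ext y
  simp only [Complex.mul_re, Complex.conj_re, Complex.conj_im]
  ring

theorem reInner_add_left {f g h : ℝ → ℂ} (hf : IsL2 f) (hg : IsL2 g) (hh : IsL2 h) :
    reInner (fun y => f y + g y) h = reInner f h + reInner g h := by
  unfold reInner
  rw [← integral_add (integrable_re_mul_conj hf hh) (integrable_re_mul_conj hg hh)]
  congr 1
  ext y
  simp [add_mul]

theorem reInner_add_right {f g h : ℝ → ℂ} (hf : IsL2 f) (hg : IsL2 g) (hh : IsL2 h) :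
    reInner h (fun y => f y + g y) = reInner h f + reInner h g := by
  rw [reInner_comm, reInner_add_left hf hg hh, reInner_comm f, reInner_comm g]

theorem reInner_smul_left (c : ℝ) (f g : ℝ → ℂ) :
    reInner (fun y => (c : ℂ) * f y) g = c * reInner f g := by
  unfold reInner
  rw [← integral_const_mul]
  congr 1
  ext y
  rw [mul_assoc, Complex.re_ofReal_mul]

theorem reInner_smul_right (c : ℝ) (f g : ℝ → ℂ) :
    reInner f (fun y => (c : ℂ) * g y) = c * reInner f g := by
  rw [reInner_comm, reInner_smul_left, reInner_comm]

theorem abs_reInner_le {f g : ℝ → ℂ} (hf : IsL2 f) (hg : IsL2 g) :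
    |reInner f g| ≤ l2Norm f * l2Norm g := by
  have key : ∀ t : ℝ, 0 ≤ l2Norm g ^ 2 * (t * t) + (2 * reInner f g) * t + l2Norm f ^ 2 := by
    intro t
    have hg' : IsL2 (fun y => (t : ℂ) * g y) := hg.const_mul t
    have h1 := reInner_self (hf.add hg')
    rw [reInner_add_left hf hg' (hf.add hg'), reInner_add_right hf hg' hf,
      reInner_add_right hf hg' hg', reInner_smul_left, reInner_smul_right, reInner_smul_right,
      reInner_smul_left, reInner_self hf, reInner_self hg, reInner_comm g f] at h1
    nlinarith [sq_nonneg (l2Norm fun y => f y + (t : ℂ) * g y)]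
  have h := discrim_le_zero key
  unfold discrim at h
  refine abs_le_of_sq_le_sq ?_ (mul_nonneg (l2Norm_nonneg f) (l2Norm_nonneg g))
  nlinarith

/-! ### Weak derivatives -/

theorem intervalIntegrable_mul_of_isL2 {F χ : ℝ → ℂ} (hF : IsL2 F) (hχ : Continuous χ) :
    IntervalIntegrable (fun y => F y * χ y) volume 0 (2 * π) := by
  have h1 : Integrable F periodMeasure := hF.2.integrable (by norm_num)
  have h2 : IntervalIntegrable F volume 0 (2 * π) := by
    rw [intervalIntegrable_iff_integrableOn_Ioc_of_le (by positivity)]; exact h1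
  exact h2.mul_continuousOn hχ.continuousOn

theorem HasWeakDeriv.add {f f₁ g g₁ : ℝ → ℂ} (hf : HasWeakDeriv f f₁) (hg : HasWeakDeriv g g₁) :
    HasWeakDeriv (fun y => f y + g y) (fun y => f₁ y + g₁ y) := by
  refine ⟨hf.1.add hg.1, hf.2.1.add hg.2.1, fun ψ hψ hp => ?_⟩
  have hd : Continuous (deriv ψ) := hψ.continuous_deriv (by simp)
  simp only [add_mul]
  rw [intervalIntegral.integral_add (intervalIntegrable_mul_of_isL2 hf.1 hd)
      (intervalIntegrable_mul_of_isL2 hg.1 hd),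
    intervalIntegral.integral_add (intervalIntegrable_mul_of_isL2 hf.2.1 hψ.continuous)
      (intervalIntegrable_mul_of_isL2 hg.2.1 hψ.continuous),
    hf.2.2 ψ hψ hp, hg.2.2 ψ hψ hp]
  ring

theorem HasWeakDeriv.const_mul {f f₁ : ℝ → ℂ} (hf : HasWeakDeriv f f₁) (c : ℂ) :
    HasWeakDeriv (fun y => c * f y) (fun y => c * f₁ y) := by
  refine ⟨hf.1.const_mul c, hf.2.1.const_mul c, fun ψ hψ hp => ?_⟩
  simp only [mul_assoc, intervalIntegral.integral_const_mul, hf.2.2 ψ hψ hp]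
  ring

theorem periodic_deriv {E : Type*} [NormedAddCommGroup E] [NormedSpace ℝ E] {a : ℝ → E} {T : ℝ}
    (hp : Function.Periodic a T) : Function.Periodic (deriv a) T := by
  intro y
  rw [← deriv_comp_add_const]
  congr 1
  ext z
  exact hp z

theorem HasWeakDeriv.smooth_mul {f f₁ : ℝ → ℂ} (hf : HasWeakDeriv f f₁) {a : ℝ → ℝ}
    (ha : ContDiff ℝ ∞ a) (hap : Function.Periodic a (2 * π)) :
    HasWeakDeriv (fun y => (a y : ℂ) * f y)
      (fun y => ((deriv a y : ℝ) : ℂ) * f y + (a y : ℂ) * f₁ y) := by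
  have hda : Continuous (deriv a) := ha.continuous_deriv (by simp)
  have hdp := periodic_deriv hap
  have hI1 := hf.1.mul_continuous hda hdp
  have hI2 := hf.2.1.mul_continuous ha.continuous hap
  refine ⟨hf.1.mul_continuous ha.continuous hap, hI1.add hI2, fun ψ hψ hp => ?_⟩
  have haC : ContDiff ℝ ∞ (fun y => (a y : ℂ)) := Complex.ofRealCLM.contDiff.comp ha
  have hd : Continuous (deriv ψ) := hψ.continuous_deriv (by simp)
  have haψ := hf.2.2 (fun y => (a y : ℂ) * ψ y) (haC.mul hψ)
    (fun y => by simp [hap y, hp y])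
  have hder : ∀ y, deriv (fun y => (a y : ℂ) * ψ y) y
      = ((deriv a y : ℝ) : ℂ) * ψ y + (a y : ℂ) * deriv ψ y := by
    intro y
    have h1 : HasDerivAt (fun y => (a y : ℂ)) ((deriv a y : ℝ) : ℂ) y :=
      ((ha.differentiable (by simp)) y).hasDerivAt.ofReal_comp
    exact (h1.mul ((hψ.differentiable (by simp)) y).hasDerivAt).deriv
  simp only [hder] at haψ
  have e1 : (fun y => f y * (((deriv a y : ℝ) : ℂ) * ψ y + (a y : ℂ) * deriv ψ y))
      = fun y => (((deriv a y : ℝ) : ℂ) * f y) * ψ y + ((a y : ℂ) * f y) * deriv ψ y := by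
    ext y; ring
  have e2 : (fun y => f₁ y * ((a y : ℂ) * ψ y)) = fun y => ((a y : ℂ) * f₁ y) * ψ y := by
    ext y; ring
  rw [e1, e2, intervalIntegral.integral_add (intervalIntegrable_mul_of_isL2 hI1 hψ.continuous)
    (intervalIntegrable_mul_of_isL2 (hf.1.mul_continuous ha.continuous hap) hd)] at haψ
  simp only [add_mul]
  rw [intervalIntegral.integral_add (intervalIntegrable_mul_of_isL2 hI1 hψ.continuous)
    (intervalIntegrable_mul_of_isL2 hI2 hψ.continuous)]
  linear_combination haψ

/-- The exponentials are admissible test functions, so the weak derivative acts on Fourier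
coefficients as multiplication by `in`. -/
theorem fourierCoeffOn_weakDeriv {f f₁ : ℝ → ℂ} (hf : HasWeakDeriv f f₁) (n : ℤ) :
    fourierCoeffOn two_pi_pos f₁ n = Complex.I * n * fourierCoeffOn two_pi_pos f n := by
  have hψ : ContDiff ℝ ∞ (fun y : ℝ => Complex.exp (-(Complex.I * n) * y)) :=
    (contDiff_const.mul Complex.ofRealCLM.contDiff).cexp
  have hp : Function.Periodic (fun y : ℝ => Complex.exp (-(Complex.I * n) * y)) (2 * π) := by
    intro y
    have : -(Complex.I * n) * ((y + 2 * π : ℝ) : ℂ)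
        = -(Complex.I * n) * y - n * (2 * π * Complex.I) := by
      push_cast; ring
    simp only [this, Complex.exp_sub, Complex.exp_int_mul_two_pi_mul_I, div_one]
  have hd : ∀ y : ℝ, deriv (fun y : ℝ => Complex.exp (-(Complex.I * n) * y)) y
      = -(Complex.I * n) * Complex.exp (-(Complex.I * n) * y) := by
    intro y
    have h1 : HasDerivAt (fun y : ℝ => -(Complex.I * n) * (y : ℂ)) (-(Complex.I * n)) y := by
      simpa using (Complex.ofRealCLM.hasDerivAt (x := y)).const_mul (-(Complex.I * n))
    rw [h1.cexp.deriv]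
    ring
  have h := hf.2.2 _ hψ hp
  simp only [hd] at h
  have hfour : ∀ y : ℝ, fourier (-n) (y : AddCircle (2 * π - 0))
      = Complex.exp (-(Complex.I * n) * y) := by
    intro y
    rw [fourier_coe_apply]
    congr 1
    have : (π : ℂ) ≠ 0 := by exact_mod_cast pi_ne_zero
    push_cast
    field_simp
    ring
  rw [fourierCoeffOn_eq_integral, fourierCoeffOn_eq_integral]
  simp only [hfour, smul_eq_mul]
  have e1 : (fun y : ℝ => f y * (-(Complex.I * n) * Complex.exp (-(Complex.I * n) * y)))
      = fun y : ℝ => -(Complex.I * n) * (Complex.exp (-(Complex.I * n) * y) * f y) := by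
    ext y; ring
  have e2 : (fun y : ℝ => f₁ y * Complex.exp (-(Complex.I * n) * y))
      = fun y : ℝ => Complex.exp (-(Complex.I * n) * y) * f₁ y := by
    ext y; ring
  rw [e1, e2, intervalIntegral.integral_const_mul] at h
  simp only [Complex.real_smul]
  linear_combination (((1 / (2 * π - 0) : ℝ) : ℂ)) * h

/-- The coefficients `c` and `inc` are orthogonal as vectors in the real plane, so Parseval yields
`‖f + f₁‖² = ‖f‖² + ‖f₁‖²`. This avoids any density or absolute continuity argument. -/
theorem reInner_weakDeriv_self {f f₁ : ℝ → ℂ} (hf : HasWeakDeriv f f₁) : reInner f f₁ = 0 := by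
  have hadd := hf.1.add hf.2.1
  have h1 := hasSum_sq_fourierCoeffOn two_pi_pos hf.1.2
  have h2 := hasSum_sq_fourierCoeffOn two_pi_pos hf.2.1.2
  have h3 := hasSum_sq_fourierCoeffOn two_pi_pos hadd.2
  have hc : ∀ n, fourierCoeffOn two_pi_pos (fun y => f y + f₁ y) n
      = fourierCoeffOn two_pi_pos f n + fourierCoeffOn two_pi_pos f₁ n := by
    intro n
    simp only [fourierCoeffOn_eq_integral]
    rw [← smul_add, ← intervalIntegral.integral_add]
    · simp only [smul_add]
    · have := intervalIntegrable_mul_of_isL2 hf.1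
        (χ := fun y : ℝ => fourier (-n) (y : AddCircle (2 * π - 0))) (by fun_prop)
      simpa only [smul_eq_mul, mul_comm] using this
    · have := intervalIntegrable_mul_of_isL2 hf.2.1
        (χ := fun y : ℝ => fourier (-n) (y : AddCircle (2 * π - 0))) (by fun_prop)
      simpa only [smul_eq_mul, mul_comm] using this
  have hn : ∀ n, ‖fourierCoeffOn two_pi_pos (fun y => f y + f₁ y) n‖ ^ 2
      = ‖fourierCoeffOn two_pi_pos f n‖ ^ 2 + ‖fourierCoeffOn two_pi_pos f₁ n‖ ^ 2 := by
    intro n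
    rw [hc, fourierCoeffOn_weakDeriv hf]
    set c := fourierCoeffOn two_pi_pos f n
    simp only [← Complex.normSq_eq_norm_sq, Complex.normSq_apply, Complex.add_re, Complex.add_im,
      Complex.mul_re, Complex.mul_im, Complex.I_re, Complex.I_im, Complex.intCast_re,
      Complex.intCast_im]
    ring
  simp only [hn] at h3
  have h4 := h3.unique (h1.add h2)
  have hconv : ∀ F : ℝ → ℂ, IsL2 F → ∫ y in (0 : ℝ)..(2 * π), ‖F y‖ ^ 2 = l2Norm F ^ 2 := by
    intro F hF
    rw [l2Norm_sq hF, intervalIntegral.integral_of_le two_pi_pos.le]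
    rfl
  rw [hconv _ hadd, hconv _ hf.1, hconv _ hf.2.1, ← smul_add] at h4
  have h5 := smul_right_injective ℝ (inv_ne_zero (by simp [pi_ne_zero] : (2 * π - 0 : ℝ) ≠ 0)) h4
  rw [← reInner_self hadd, reInner_add_left hf.1 hf.2.1 hadd, reInner_add_right hf.1 hf.2.1 hf.1,
    reInner_add_right hf.1 hf.2.1 hf.2.1, reInner_self hf.1, reInner_self hf.2.1,
    reInner_comm f₁ f] at h5
  linarith

/-- Polarization of `reInner_weakDeriv_self`: integration by parts for two weakly differentiable
functions. -/
theorem reInner_weakDeriv {f f₁ g g₁ : ℝ → ℂ} (hf : HasWeakDeriv f f₁) (hg : HasWeakDeriv g g₁) :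
    reInner f g₁ = -reInner f₁ g := by
  have h := reInner_weakDeriv_self (hf.add hg)
  rw [reInner_add_left hf.1 hg.1 (hf.2.1.add hg.2.1), reInner_add_right hf.2.1 hg.2.1 hf.1,
    reInner_add_right hf.2.1 hg.2.1 hg.1, reInner_weakDeriv_self hf, reInner_weakDeriv_self hg,
    reInner_comm g f₁] at h
  linarith

/-! ### A bounded multiplier adapted to the critical point of the profile -/

/-- The vector field `cos y / √(1 + (1 - sin y) / k)`, shifted by `θ`: it behaves like `cos` in a
neighbourhood of size `√k` of the maximum of `sin` and is bounded by `√(2k)`. -/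
noncomputable def truncCos (k θ y : ℝ) : ℝ :=
  cos (y + θ) / √(1 + (1 - sin (y + θ)) / k)

section

variable {k θ : ℝ}

theorem one_le_truncCos_denom (hk : 0 < k) (y : ℝ) : 1 ≤ 1 + (1 - sin (y + θ)) / k := by
  have := div_nonneg (sub_nonneg.2 (sin_le_one (y + θ))) hk.le
  linarith

theorem contDiff_truncCos (hk : 0 < k) : ContDiff ℝ ∞ (truncCos k θ) := by
  unfold truncCos
  have hs : ContDiff ℝ ∞ (fun y : ℝ => sin (y + θ)) :=
    contDiff_sin.comp (contDiff_id.add contDiff_const)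
  have hc : ContDiff ℝ ∞ (fun y : ℝ => cos (y + θ)) :=
    contDiff_cos.comp (contDiff_id.add contDiff_const)
  have hz : ContDiff ℝ ∞ (fun y : ℝ => 1 + (1 - sin (y + θ)) / k) :=
    contDiff_const.add ((contDiff_const.sub hs).div_const k)
  refine hc.div (hz.sqrt fun y => ?_) fun y => ?_
  · linarith [one_le_truncCos_denom (θ := θ) hk y]
  · exact (sqrt_pos.2 (by linarith [one_le_truncCos_denom (θ := θ) hk y])).ne'

theorem periodic_truncCos : Function.Periodic (truncCos k θ) (2 * π) := by
  intro y
  unfold truncCos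
  rw [show y + 2 * π + θ = y + θ + 2 * π by ring, sin_add_two_pi, cos_add_two_pi]

/-- Here `r` is the damping factor `(1 + (1 - sin)/k)^(-1/2)`. With `m = 1 - sin` and `cos² = m(2 -
m)`, every later bound on the multiplier is a polynomial inequality in `r`, `m`, `k`. -/
theorem truncCos_spec (hk : 0 < k) (y : ℝ) : ∃ r : ℝ, 0 < r ∧ r ≤ 1 ∧
    r ^ 2 * (k + (1 - sin (y + θ))) = k ∧ truncCos k θ y = cos (y + θ) * r ∧
    deriv (truncCos k θ) y
      = r * ((1 - sin (y + θ)) / 2 - (1 - (1 - sin (y + θ)) / 2) * r ^ 2) := by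
  have hz := one_le_truncCos_denom (θ := θ) hk y
  set z := 1 + (1 - sin (y + θ)) / k with hzdef
  have hz0 : 0 < z := by linarith
  have hsz : 0 < √z := sqrt_pos.2 hz0
  have hsq : √z ^ 2 = z := sq_sqrt hz0.le
  have hrz : (√z)⁻¹ ^ 2 * (k + (1 - sin (y + θ))) = k := by
    rw [inv_pow, hsq, show k + (1 - sin (y + θ)) = k * z by rw [hzdef]; field_simp]
    field_simp
  refine ⟨(√z)⁻¹, inv_pos.2 hsz, inv_le_one_of_one_le₀ (one_le_sqrt.2 hz), hrz, ?_, ?_⟩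
  · rw [truncCos, ← hzdef, div_eq_mul_inv]
  · have hs : HasDerivAt (fun y : ℝ => sin (y + θ)) (cos (y + θ)) y := by
      simpa using ((hasDerivAt_id y).add_const θ).sin
    have hc : HasDerivAt (fun y : ℝ => cos (y + θ)) (-sin (y + θ)) y := by
      simpa using ((hasDerivAt_id y).add_const θ).cos
    have hzd : HasDerivAt (fun y : ℝ => 1 + (1 - sin (y + θ)) / k) (-cos (y + θ) / k) y := by
      simpa using ((hs.const_sub 1).div_const k).const_add 1
    have hd := hc.div (hzd.sqrt hz0.ne') hsz.ne'
    have hd' : deriv (truncCos k θ) y = _ := hd.deriv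
    rw [hd', ← hzdef]
    have hcs : cos (y + θ) ^ 2 = 1 - sin (y + θ) ^ 2 := by
      rw [← sin_sq_add_cos_sq (y + θ)]; ring
    set r := (√z)⁻¹ with hr
    have hrs : √z = r⁻¹ := by rw [hr, inv_inv]
    have hr0 : r ≠ 0 := (inv_pos.2 hsz).ne'
    rw [hrs]
    field_simp
    set S := sin (y + θ)
    rw [hcs]
    linear_combination (1 + S) * hrz

theorem abs_truncCos_le (hk : 0 < k) (y : ℝ) : |truncCos k θ y| ≤ √(2 * k) := by
  obtain ⟨r, hr0, hr1, hr, ha, -⟩ := truncCos_spec (θ := θ) hk y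
  refine abs_le_sqrt ?_
  have hcs : cos (y + θ) ^ 2 = 1 - sin (y + θ) ^ 2 := by
    rw [← sin_sq_add_cos_sq (y + θ)]; ring
  rw [ha, mul_pow, hcs]
  nlinarith [sin_le_one (y + θ), neg_one_le_sin (y + θ), sq_nonneg r,
    mul_nonneg (sq_nonneg r) (sq_nonneg (1 - sin (y + θ)))]

theorem neg_one_le_deriv_truncCos (hk : 0 < k) (y : ℝ) : -1 ≤ deriv (truncCos k θ) y := by
  obtain ⟨r, hr0, hr1, hr, -, hd⟩ := truncCos_spec (θ := θ) hk y
  rw [hd]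
  have h1 := sin_le_one (y + θ)
  have h2 := neg_one_le_sin (y + θ)
  set m := 1 - sin (y + θ) with hm
  have h3 : r ^ 3 ≤ 1 := pow_le_one₀ hr0.le hr1
  have h4 : 0 < r ^ 3 := by positivity
  nlinarith [mul_nonneg hr0.le (by linarith : 0 ≤ m), mul_nonneg h4.le (by linarith : 0 ≤ m)]

theorem deriv_truncCos_le (hk : 0 < k) (hk6 : k ≤ 6) (y : ℝ) :
    deriv (truncCos k θ) y ≤ 7 / 8 := by
  obtain ⟨r, hr0, hr1, hr, -, hd⟩ := truncCos_spec (θ := θ) hk y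
  rw [hd]
  have h1 := sin_le_one (y + θ)
  have h2 := neg_one_le_sin (y + θ)
  set m := 1 - sin (y + θ) with hm
  have hm0 : 0 ≤ m := by linarith
  have hm2 : m ≤ 2 := by linarith
  have h4 : 0 < r ^ 3 := by positivity
  have h5 : (r * m / 2) ^ 2 ≤ 3 / 4 := by
    -- Since `r²(k + m) = k`, this says `k m² ≤ 3(k + m)`. At the extreme `m = 2` it reads `4k ≤ 3(k
    -- + 2)`, which is where `k ≤ 6` is needed.
    have h6 : r ^ 2 * m ^ 2 * (k + m) ≤ 3 * (k + m) := by
      nlinarith [mul_nonneg hm0 (by linarith : 0 ≤ 2 - m), mul_nonneg hk.le hm0]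
    have h7 := le_of_mul_le_mul_right h6 (by linarith)
    nlinarith
  have h8 : r * m / 2 ≤ 7 / 8 := by nlinarith [mul_nonneg hr0.le hm0]
  nlinarith [mul_nonneg h4.le (by linarith : 0 ≤ 2 - m)]

/-- As `1 + a' ≥ 0`, the factor `λ - sin` may be replaced by `m - e`, with `m = 1 - sin`. The loss
`e(1 + a')` is at most `m/2 + mr`, because `1 - r³ ≤ (3/2)(1 - r²)`, `k(1 - r²) ≤ m` and `3e ≤ k`.
The surplus left over is `m(r - r³)(1 - m/2) ≥ 0`. -/
theorem truncCos_coercive (hk : 0 < k) {e lam : ℝ} (he1 : e ≤ 1)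
    (hek : 3 * e ≤ k) (hel : 1 - lam ≤ e) (y : ℝ) :
    (1 - sin (y + θ)) / 2 ≤ truncCos k θ y * cos (y + θ)
      + (1 + deriv (truncCos k θ) y) * (lam - sin (y + θ)) := by
  have hlow := neg_one_le_deriv_truncCos (θ := θ) hk y
  obtain ⟨r, hr0, hr1, hr, ha, hd⟩ := truncCos_spec (θ := θ) hk y
  have h1 := sin_le_one (y + θ)
  have h2 := neg_one_le_sin (y + θ)
  have hcs : cos (y + θ) ^ 2 = 1 - sin (y + θ) ^ 2 := by
    rw [← sin_sq_add_cos_sq (y + θ)]; ring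
  rw [ha, show cos (y + θ) * r * cos (y + θ) = cos (y + θ) ^ 2 * r by ring, hcs]
  set m := 1 - sin (y + θ) with hm
  have hsin : sin (y + θ) = 1 - m := by rw [hm]; ring
  have hm0 : 0 ≤ m := by linarith
  have hm2 : m ≤ 2 := by linarith
  set d := deriv (truncCos k θ) y with hd'
  have hstep : (1 + d) * (m - e) ≤ (1 + d) * (lam - sin (y + θ)) := by
    apply mul_le_mul_of_nonneg_left _ (by linarith)
    linarith
  rw [hsin] at hstep ⊢
  have hx : 1 + d = (1 - r ^ 3) + m / 2 * (r ^ 3 + r) := by rw [hd]; ring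
  have hr3 : r ^ 3 ≤ r := by nlinarith [mul_pos hr0 hr0]
  have hA : e * (1 - r ^ 3) ≤ m / 2 := by
    have h3 : 1 - r ^ 3 ≤ 3 / 2 * (1 - r ^ 2) := by
      nlinarith [mul_nonneg (sub_nonneg.2 hr1) (sub_nonneg.2 hr1), mul_pos hr0 hr0,
        mul_nonneg (mul_nonneg (sub_nonneg.2 hr1) (sub_nonneg.2 hr1)) hr0.le]
    have h4 : k * (1 - r ^ 2) ≤ m := by nlinarith [mul_pos hr0 hr0]
    have h5 : 0 ≤ 1 - r ^ 2 := by nlinarith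
    nlinarith
  have hB : e * (m / 2 * (r ^ 3 + r)) ≤ m * r := by
    have h3 : m / 2 * (r ^ 3 + r) ≤ m * r := by nlinarith
    have h4 : 0 ≤ m / 2 * (r ^ 3 + r) := by positivity
    nlinarith
  have hC : 0 ≤ m * ((r - r ^ 3) * (1 - m / 2)) :=
    mul_nonneg hm0 (mul_nonneg (by linarith) (by linarith))
  have hfin : m / 2 ≤ (1 - (1 - m) ^ 2) * r + (1 + d) * (m - e) := by
    rw [hx]
    nlinarith
  linarith

end

/-! ### Energy identities -/

/-- Integrable over one period with vanishing integral. -/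
def IsZeroMean (Z : ℝ → ℝ) : Prop :=
  Integrable Z periodMeasure ∧ ∫ y, Z y ∂periodMeasure = 0

theorem IsZeroMean.add {Z Z' : ℝ → ℝ} (h : IsZeroMean Z) (h' : IsZeroMean Z') :
    IsZeroMean (fun y => Z y + Z' y) :=
  ⟨h.1.add h'.1, by rw [integral_add h.1 h'.1, h.2, h'.2, add_zero]⟩

theorem IsZeroMean.const_mul {Z : ℝ → ℝ} (h : IsZeroMean Z) (c : ℝ) :
    IsZeroMean (fun y => c * Z y) :=
  ⟨h.1.const_mul c, by rw [integral_const_mul, h.2, mul_zero]⟩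

/-- The form of every energy identity below: two integrands agree up to exact derivatives, so each
proof names those derivatives and the rest is pointwise algebra. -/
theorem integral_eq_of_ae_eq_add {E P Z : ℝ → ℝ} (hP : Integrable P periodMeasure)
    (hZ : IsZeroMean Z) (h : ∀ᵐ y ∂periodMeasure, E y = P y + Z y) :
    ∫ y, E y ∂periodMeasure = ∫ y, P y ∂periodMeasure := by
  rw [integral_congr_ae h, integral_add hP hZ.1, hZ.2, add_zero]

/-- The derivative of `a f ḡ` has zero mean. -/
theorem isZeroMean_weighted {f f₁ g g₁ : ℝ → ℂ} (hf : HasWeakDeriv f f₁) (hg : HasWeakDeriv g g₁)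
    {a : ℝ → ℝ} (ha : ContDiff ℝ ∞ a) (hap : Function.Periodic a (2 * π)) :
    IsZeroMean (fun y => deriv a y * (f y * conj (g y)).re
      + a y * ((f₁ y * conj (g y)).re + (f y * conj (g₁ y)).re)) := by
  have haf := hf.smooth_mul ha hap
  have h := reInner_weakDeriv haf hg
  have e : (fun y => deriv a y * (f y * conj (g y)).re
      + a y * ((f₁ y * conj (g y)).re + (f y * conj (g₁ y)).re))
      = fun y => ((((deriv a y : ℝ) : ℂ) * f y + (a y : ℂ) * f₁ y) * conj (g y)).re
        + (((a y : ℂ) * f y) * conj (g₁ y)).re := by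
    ext y
    simp only [Complex.mul_re, Complex.add_re, Complex.add_im, Complex.mul_im, Complex.ofReal_re,
      Complex.ofReal_im]
    ring
  have i1 := integrable_re_mul_conj haf.2.1 hg.1
  have i2 := integrable_re_mul_conj haf.1 hg.2.1
  rw [e]
  refine ⟨i1.fun_add i2, ?_⟩
  rw [integral_add i1 i2]
  unfold reInner at h
  linarith

theorem isZeroMean_deriv {f f₁ g g₁ : ℝ → ℂ} (hf : HasWeakDeriv f f₁) (hg : HasWeakDeriv g g₁) :
    IsZeroMean (fun y => (f₁ y * conj (g y)).re + (f y * conj (g₁ y)).re) := by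
  have := isZeroMean_weighted hf hg (a := fun _ => 1) contDiff_const (fun _ => rfl)
  simpa using this

/-- The expression `(sin (y + θ) - lam) g + lam φ`, which is the Rayleigh operator applied to
`w = g - φ`. -/
noncomputable def rayleighExpr (lam θ : ℝ) (g φ : ℝ → ℂ) : ℝ → ℂ := fun y =>
  ((sin (y + θ) - lam : ℝ) : ℂ) * g y + (lam : ℂ) * φ y

theorem contDiff_sin_add (θ : ℝ) : ContDiff ℝ ∞ (fun y : ℝ => sin (y + θ)) :=
  contDiff_sin.comp (contDiff_id.add contDiff_const)

theorem contDiff_cos_add (θ : ℝ) : ContDiff ℝ ∞ (fun y : ℝ => cos (y + θ)) :=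
  contDiff_cos.comp (contDiff_id.add contDiff_const)

theorem periodic_sin_add (θ : ℝ) : Function.Periodic (fun y : ℝ => sin (y + θ)) (2 * π) := by
  intro y
  simp only [show y + 2 * π + θ = y + θ + 2 * π by ring, sin_add_two_pi]

theorem periodic_cos_add (θ : ℝ) : Function.Periodic (fun y : ℝ => cos (y + θ)) (2 * π) := by
  intro y
  simp only [show y + 2 * π + θ = y + θ + 2 * π by ring, cos_add_two_pi]

theorem hasDerivAt_sin_add (θ y : ℝ) : HasDerivAt (fun y : ℝ => sin (y + θ)) (cos (y + θ)) y := by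
  simpa using ((hasDerivAt_id y).add_const θ).sin

theorem hasDerivAt_cos_add (θ y : ℝ) :
    HasDerivAt (fun y : ℝ => cos (y + θ)) (-sin (y + θ)) y := by
  simpa using ((hasDerivAt_id y).add_const θ).cos

theorem isL2_rayleighExpr {g φ : ℝ → ℂ} (hg : IsL2 g) (hφ : IsL2 φ) (lam θ : ℝ) :
    IsL2 (rayleighExpr lam θ g φ) := by
  refine (hg.mul_continuous (a := fun y => sin (y + θ) - lam)
    ((contDiff_sin_add θ).continuous.sub continuous_const) fun y => ?_).add (hφ.const_mul _)
  have := periodic_sin_add θ y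
  simp only at this ⊢
  rw [this]

/-- Expand `|φ'' - cφ|²` and integrate the cross term by parts. -/
theorem l2Norm_sq_helmholtz {φ φ₁ φ₂ w : ℝ → ℂ} {c : ℝ} (hφ : HasWeakDeriv φ φ₁)
    (hφ₁ : HasWeakDeriv φ₁ φ₂) (hw : IsL2 w)
    (h : ∀ᵐ y ∂periodMeasure, φ₂ y = w y + c * φ y) :
    l2Norm w ^ 2 = l2Norm φ₂ ^ 2 + 2 * c * l2Norm φ₁ ^ 2 + c ^ 2 * l2Norm φ ^ 2 := by
  rw [l2Norm_sq hw, l2Norm_sq hφ.1, l2Norm_sq hφ.2.1, l2Norm_sq hφ₁.2.1]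
  have i0 := integrable_norm_sq hφ.1
  have i1 := integrable_norm_sq hφ.2.1
  have i2 := integrable_norm_sq hφ₁.2.1
  rw [← integral_const_mul, ← integral_const_mul, ← integral_add i2 (i1.const_mul _),
    ← integral_add (i2.fun_add (i1.const_mul _)) (i0.const_mul _)]
  refine integral_eq_of_ae_eq_add ((i2.fun_add (i1.const_mul _)).fun_add (i0.const_mul _))
    ((isZeroMean_deriv hφ hφ₁).const_mul (-2 * c)) ?_
  filter_upwards [h] with y hy
  have : w y = φ₂ y - c * φ y := by rw [hy]; ring
  rw [this]
  simp only [Complex.sq_norm, Complex.normSq_apply, Complex.mul_re, Complex.mul_im,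
    Complex.sub_re, Complex.sub_im, Complex.ofReal_re, Complex.ofReal_im, Complex.conj_re,
    Complex.conj_im]
  ring

section

variable {g g₁ g₂ φ φ₁ φ₂ : ℝ → ℂ} {b : ℝ}

/-- The transport part drops out: `i(sin - λ)|g|²` is imaginary, and `⟨φ, g⟩ = ⟨φ, φ'' - bφ⟩` is
real. -/
theorem reInner_resolvent_self {A lam θ : ℝ} {F : ℝ → ℂ} (hg : HasWeakDeriv g g₁)
    (hg₁ : HasWeakDeriv g₁ g₂) (hφ : HasWeakDeriv φ φ₁) (hφ₁ : HasWeakDeriv φ₁ φ₂)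
    (h : ∀ᵐ y ∂periodMeasure, φ₂ y = g y + b * φ y)
    (hF : ∀ᵐ y ∂periodMeasure,
      F y = Complex.I * A * rayleighExpr lam θ g φ y - (g₂ y - φ₂ y)) :
    reInner F g = l2Norm g₁ ^ 2 + l2Norm φ₂ ^ 2 + b * l2Norm φ₁ ^ 2 := by
  rw [l2Norm_sq hg.2.1, l2Norm_sq hφ.2.1, l2Norm_sq hφ₁.2.1]
  have i0 := integrable_norm_sq hg.2.1
  have i1 := integrable_norm_sq hφ.2.1
  have i2 := integrable_norm_sq hφ₁.2.1
  rw [← integral_const_mul, ← integral_add i0 i2, ← integral_add (i0.fun_add i2) (i1.const_mul _)]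
  refine integral_eq_of_ae_eq_add ((i0.fun_add i2).fun_add (i1.const_mul _))
    ((((isZeroMean_deriv hg₁ hg).const_mul (-1)).add
      ((isZeroMean_deriv hφ₁ hφ).const_mul (-b))).add
      ((isZeroMean_deriv (hφ.const_mul Complex.I) hφ₁).const_mul (A * lam))) ?_
  filter_upwards [h, hF] with y hy hFy
  rw [hFy]
  have : g y = φ₂ y - b * φ y := by rw [hy]; ring
  simp only [rayleighExpr]
  rw [this]
  simp only [Complex.sq_norm, Complex.normSq_apply, Complex.mul_re, Complex.mul_im,
    Complex.sub_re, Complex.sub_im, Complex.ofReal_re, Complex.ofReal_im, Complex.conj_re,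
    Complex.conj_im, Complex.I_re, Complex.I_im, Complex.add_re, Complex.add_im]
  ring

/-- Pair with `g''`. Only the derivative falling on `sin` survives; the nonlocal term vanishes,
since `⟨φ, g''⟩ = ⟨φ'', g⟩ = ⟨φ'', φ'' - bφ⟩` is real. -/
theorem l2Norm_sq_second_deriv {A lam θ : ℝ} {F : ℝ → ℂ} (hg : HasWeakDeriv g g₁)
    (hg₁ : HasWeakDeriv g₁ g₂) (hφ : HasWeakDeriv φ φ₁) (hφ₁ : HasWeakDeriv φ₁ φ₂)
    (h : ∀ᵐ y ∂periodMeasure, φ₂ y = g y + b * φ y) (hFL : IsL2 F)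
    (hF : ∀ᵐ y ∂periodMeasure,
      F y = Complex.I * A * rayleighExpr lam θ g φ y - (g₂ y - φ₂ y)) :
    l2Norm g₂ ^ 2 = -reInner F g₂ + reInner φ₂ g₂
      - A * reInner (fun y => ((cos (y + θ) : ℝ) : ℂ) * (Complex.I * g y)) g₁ := by
  have hcg : IsL2 (fun y => ((cos (y + θ) : ℝ) : ℂ) * (Complex.I * g y)) :=
    (hg.1.const_mul _).mul_continuous (contDiff_cos_add θ).continuous (periodic_cos_add θ)
  have hsm : ContDiff ℝ ∞ (fun y : ℝ => sin (y + θ) - lam) :=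
    (contDiff_sin_add θ).sub contDiff_const
  have hsp : Function.Periodic (fun y : ℝ => sin (y + θ) - lam) (2 * π) := by
    intro y
    have := periodic_sin_add θ y
    simp only at this ⊢
    rw [this]
  have hsd : ∀ y, deriv (fun y : ℝ => sin (y + θ) - lam) y = cos (y + θ) := fun y =>
    ((hasDerivAt_sin_add θ y).sub_const lam).deriv
  have i0 := integrable_norm_sq hg₁.2.1
  have iF := integrable_re_mul_conj hFL hg₁.2.1
  have i1 := integrable_re_mul_conj hφ₁.2.1 hg₁.2.1
  have i2 := integrable_re_mul_conj hcg hg.2.1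
  have key : ∫ y, ‖g₂ y‖ ^ 2 ∂periodMeasure = ∫ y, (-(F y * conj (g₂ y)).re
      + (φ₂ y * conj (g₂ y)).re
      - A * ((((cos (y + θ) : ℝ) : ℂ) * (Complex.I * g y)) * conj (g₁ y)).re) ∂periodMeasure := by
    refine integral_eq_of_ae_eq_add ((iF.fun_neg.fun_add i1).sub' (i2.const_mul A))
      ((((isZeroMean_weighted (hg.const_mul Complex.I) hg₁ hsm hsp).const_mul A).add
        ((isZeroMean_deriv (hφ.const_mul Complex.I) hg₁).const_mul (A * lam))).add
        (((isZeroMean_deriv (hφ₁.const_mul Complex.I) hg).const_mul (-(A * lam))).add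
        ((isZeroMean_deriv (hφ.const_mul Complex.I) hφ₁).const_mul (A * lam * b)))) ?_
    filter_upwards [h, hF] with y hy hFy
    rw [hFy, hsd]
    have : g y = φ₂ y - b * φ y := by rw [hy]; ring
    simp only [rayleighExpr]
    rw [this]
    simp only [Complex.sq_norm, Complex.normSq_apply, Complex.mul_re, Complex.mul_im,
      Complex.sub_re, Complex.sub_im, Complex.ofReal_re, Complex.ofReal_im, Complex.conj_re,
      Complex.conj_im, Complex.I_re, Complex.I_im, Complex.add_re, Complex.add_im]
    ring
  rw [l2Norm_sq hg₁.2.1, key]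
  unfold reInner
  have i3 : Integrable (fun y => -(F y * conj (g₂ y)).re + (φ₂ y * conj (g₂ y)).re)
    periodMeasure := iF.fun_neg.fun_add i1
  rw [integral_sub i3 (i2.const_mul A), integral_add iF.fun_neg i1, integral_neg, integral_const_mul]

/-- The commutator identity behind the resolvent estimate, for a general multiplier `a`. -/
theorem neg_reInner_rayleigh_multiplier {lam θ : ℝ} {a : ℝ → ℝ} (ha : ContDiff ℝ ∞ a)
    (hap : Function.Periodic a (2 * π)) (hg : HasWeakDeriv g g₁)
    (hφ : HasWeakDeriv φ φ₁) (hφ₁ : HasWeakDeriv φ₁ φ₂)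
    (h : ∀ᵐ y ∂periodMeasure, φ₂ y = g y + b * φ y) :
    -reInner (rayleighExpr lam θ g φ)
        (fun y => ((2 * a y : ℝ) : ℂ) * g₁ y + ((2 * deriv a y + 1 : ℝ) : ℂ) * g y)
      = ∫ y, ((a y * cos (y + θ) + (1 + deriv a y) * (lam - sin (y + θ))) * ‖g y‖ ^ 2
          + lam * ((1 - deriv a y) * ‖φ₁ y‖ ^ 2)
          + lam * b * ((1 + deriv a y) * ‖φ y‖ ^ 2)) ∂periodMeasure := by
  have hsm : ContDiff ℝ ∞ (fun y : ℝ => a y * (sin (y + θ) - lam)) :=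
    ha.mul ((contDiff_sin_add θ).sub contDiff_const)
  have hsp : Function.Periodic (fun y : ℝ => a y * (sin (y + θ) - lam)) (2 * π) := by
    intro y
    have := periodic_sin_add θ y
    simp only at this ⊢
    rw [this, hap y]
  have hsd : ∀ y, deriv (fun y : ℝ => a y * (sin (y + θ) - lam)) y
      = deriv a y * (sin (y + θ) - lam) + a y * cos (y + θ) := fun y =>
    ((ha.differentiable (by simp) y).hasDerivAt.mul
      ((hasDerivAt_sin_add θ y).sub_const lam)).deriv
  have hda : Continuous (deriv a) := ha.continuous_deriv (by simp)
  have hac := ha.continuous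
  have i0 := integrable_weight (a := fun y => a y * cos (y + θ)
    + (1 + deriv a y) * (lam - sin (y + θ))) (by fun_prop) (integrable_norm_sq hg.1)
  have i1 := integrable_weight (a := fun y => 1 - deriv a y) (by fun_prop)
    (integrable_norm_sq hφ.2.1)
  have i2 := integrable_weight (a := fun y => 1 + deriv a y) (by fun_prop)
    (integrable_norm_sq hφ.1)
  unfold reInner
  rw [← integral_neg]
  refine integral_eq_of_ae_eq_add ((i0.fun_add (i1.const_mul lam)).add (i2.const_mul (lam * b)))
    ((((isZeroMean_weighted hg hg hsm hsp).const_mul (-1)).add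
      ((isZeroMean_weighted hφ hg ha hap).const_mul (-2 * lam))).add
      (((isZeroMean_weighted hφ₁ hφ₁ ha hap).const_mul lam).add
      (((isZeroMean_weighted hφ hφ ha hap).const_mul (-(lam * b))).add
      ((isZeroMean_deriv hφ hφ₁).const_mul (-lam))))) ?_
  filter_upwards [h] with y hy
  have : φ₂ y = g y + b * φ y := hy
  rw [hsd]
  simp only [rayleighExpr]
  rw [this]
  simp only [Complex.sq_norm, Complex.normSq_apply, Complex.mul_re, Complex.mul_im,
    Complex.ofReal_re, Complex.ofReal_im, Complex.conj_re,
    Complex.conj_im, Complex.add_re, Complex.add_im]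
  ring

/-- Splitting `sin - λ = (1 - λ) - (1 - sin)` exposes the distance of `λ` to the critical value `1`,
which this identity serves to bound. -/
theorem reInner_rayleigh_self {lam θ : ℝ} (hg : IsL2 g)
    (hφ : HasWeakDeriv φ φ₁) (hφ₁ : HasWeakDeriv φ₁ φ₂)
    (h : ∀ᵐ y ∂periodMeasure, φ₂ y = g y + b * φ y) :
    reInner (rayleighExpr lam θ g φ) g = (1 - lam) * l2Norm g ^ 2
      - ∫ y, (1 - sin (y + θ)) * ‖g y‖ ^ 2 ∂periodMeasure
      - lam * (l2Norm φ₁ ^ 2 + b * l2Norm φ ^ 2) := by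
  have hs := (contDiff_sin_add θ).continuous
  have i0 := integrable_norm_sq hg
  have i1 := integrable_weight (a := fun y => 1 - sin (y + θ)) (by fun_prop) i0
  have i2 := integrable_norm_sq hφ.1
  have i3 := integrable_norm_sq hφ.2.1
  rw [l2Norm_sq hg, l2Norm_sq hφ.1, l2Norm_sq hφ.2.1, ← integral_const_mul, ← integral_const_mul,
    ← integral_add i3 (i2.const_mul b), ← integral_const_mul, ← integral_sub (i0.const_mul _) i1,
    ← integral_sub ((i0.const_mul _).sub' i1) ((i3.fun_add (i2.const_mul b)).const_mul lam)]
  refine integral_eq_of_ae_eq_add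
    (((i0.const_mul _).sub' i1).sub ((i3.fun_add (i2.const_mul b)).const_mul lam))
    ((isZeroMean_deriv hφ hφ₁).const_mul lam) ?_
  filter_upwards [h] with y hy
  rw [hy]
  simp only [rayleighExpr, Complex.sq_norm, Complex.normSq_apply, Complex.mul_re, Complex.mul_im,
    Complex.ofReal_re, Complex.ofReal_im, Complex.conj_re,
    Complex.conj_im, Complex.add_re, Complex.add_im]
  ring

/-- Used with `a = cos` as an uncertainty inequality for `g`, and with `a = truncCos` to recover
`‖φ‖` from the degenerate weight `1 + a'`. -/
theorem integral_neg_deriv_mul_norm_sq {a : ℝ → ℝ} (ha : ContDiff ℝ ∞ a)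
    (hap : Function.Periodic a (2 * π)) (hg : HasWeakDeriv g g₁) :
    ∫ y, -deriv a y * ‖g y‖ ^ 2 ∂periodMeasure = 2 * reInner (fun y => (a y : ℂ) * g y) g₁ := by
  have hi := integrable_re_mul_conj (hg.1.mul_continuous ha.continuous hap) hg.2.1
  unfold reInner
  rw [← integral_const_mul]
  refine integral_eq_of_ae_eq_add (hi.const_mul 2)
    ((isZeroMean_weighted hg hg ha hap).const_mul (-1)) (Filter.Eventually.of_forall fun y => ?_)
  simp only [Complex.sq_norm, Complex.normSq_apply, Complex.mul_re, Complex.mul_im,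
    Complex.ofReal_re, Complex.ofReal_im, Complex.conj_re, Complex.conj_im]
  ring

end

/-! ### Closing the estimate -/

/-- The energy inequalities for `g` of norm one force the norm `F` of the right-hand side to be at
least of order `s`. -/
theorem le_of_energy_estimates {s lam b e k F G₁ G₂ P₀ P₁ P₂ Q X R q κ I : ℝ}
    (hs : 1 ≤ s) (hlam : 0 ≤ lam) (hb : 0 ≤ b) (he : e = max (1 - lam) 0)
    (hk : k = 3 * (e + 1 / s)) (hG₁ : 0 ≤ G₁) (hG₂ : 0 ≤ G₂) (hP₀ : 0 ≤ P₀)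
    (hX : 0 ≤ X) (hR : 0 ≤ R)
    (hq : 0 ≤ q) (hqQ : q ^ 2 = 2 * Q) (hκ : 0 ≤ κ) (hκk : κ ^ 2 = 2 * k)
    (h1 : G₁ ^ 2 + P₂ ^ 2 + b * P₁ ^ 2 ≤ F)
    (h2 : G₂ ^ 2 ≤ (F + P₂) * G₂ + s ^ 2 * (q * G₁))
    (h3 : s ^ 2 * R ≤ F + G₂ + P₂)
    (h4 : Q / 2 + lam * P₁ ^ 2 / 8 + lam * b * X ≤ R * (2 * κ * G₁ + 3))
    (h5 : 1 ≤ Q + 2 * (q * G₁))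
    (h6 : P₀ ^ 2 ≤ X + 2 * κ * (P₀ * P₁))
    (h7 : 1 - lam = Q + lam * (P₁ ^ 2 + b * P₀ ^ 2) + I) (hI : |I| ≤ R)
    (h8 : b * P₀ ≤ 1) : s / 10 ^ 8 ≤ F := by
  by_contra! hlt
  have hs0 : 0 < s := by linarith
  have he0 : 0 ≤ e := he ▸ le_max_right _ _
  have hQ0 : 0 ≤ Q := by linarith [sq_nonneg q]
  set Y := R * (2 * κ * G₁ + 3) with hY
  have hY0 : 0 ≤ Y := by positivity
  have hbX : 0 ≤ lam * b * X := by positivity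
  have hlP : 0 ≤ lam * P₁ ^ 2 := by positivity
  have hQY : Q ≤ 2 * Y := by linarith
  have hPY : lam * P₁ ^ 2 ≤ 8 * Y := by linarith
  have hXY : lam * b * X ≤ Y := by linarith
  have hRY : R ≤ Y / 3 := by
    have h0 : 0 ≤ R * (2 * κ * G₁) := by positivity
    have h1 : Y = R * (2 * κ * G₁) + 3 * R := by rw [hY]; ring
    linarith
  have hP₀2 : P₀ ^ 2 ≤ 2 * X + 8 * k * P₁ ^ 2 := by
    have h0 : (P₀ - 2 * κ * P₁) ^ 2 = P₀ ^ 2 - 2 * (2 * κ * (P₀ * P₁)) + 4 * (κ ^ 2 * P₁ ^ 2) := by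
      ring
    have h1 := sq_nonneg (P₀ - 2 * κ * P₁)
    rw [h0, hκk] at h1
    linarith
  have h1s : 0 < 1 / s := by positivity
  -- the distance of `lam` to the critical value
  have heY : e ≤ 400 * Y + 1 / s := by
    rcases le_total (1 - lam) 0 with hl | hl
    · rw [he, max_eq_right hl]; positivity
    · have hee : e = 1 - lam := by rw [he, max_eq_left hl]
      have hII := (abs_le.1 hI).2
      have hk0 : 0 < k := by rw [hk]; positivity
      -- For `bk ≤ 6` the term `λbP₀²` is controlled by the coercive quantities through `hP₀2`. For
      -- `bk ≥ 6`, `bP₀ ≤ 1` gives `bP₀² ≤ k/6 = (e + 1/s)/2`, and the `e/2` is absorbed on the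
      -- left.
      rcases le_total (b * k) 6 with hbk | hbk
      · have : lam * b * P₀ ^ 2 ≤ 2 * (lam * b * X) + 8 * 6 * (lam * P₁ ^ 2) := by
          have t1 : lam * b * P₀ ^ 2 ≤ lam * b * (2 * X + 8 * k * P₁ ^ 2) :=
            mul_le_mul_of_nonneg_left hP₀2 (by positivity)
          have t2 : b * k * (lam * P₁ ^ 2) ≤ 6 * (lam * P₁ ^ 2) :=
            mul_le_mul_of_nonneg_right hbk hlP
          linarith
        linarith
      · have : lam * b * P₀ ^ 2 ≤ e / 2 + 1 / s / 2 := by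
          have hl1 : lam ≤ 1 := by linarith
          have t0 : 0 ≤ b * P₀ ^ 2 := by positivity
          have t1 : lam * b * P₀ ^ 2 ≤ b * P₀ ^ 2 := by
            rw [mul_assoc]; exact mul_le_of_le_one_left t0 hl1
          have t2 : (b * P₀) ^ 2 ≤ 1 := by
            have : 0 ≤ b * P₀ := by positivity
            exact pow_le_one₀ this h8
          have t3 : 6 * (b * P₀ ^ 2) ≤ k := by
            have u1 : b * k * (b * P₀ ^ 2) = k * (b * P₀) ^ 2 := by ring
            have u2 : k * (b * P₀) ^ 2 ≤ k := mul_le_of_le_one_right hk0.le t2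
            have u3 := mul_le_mul_of_nonneg_right hbk t0
            linarith
          rw [hk] at t3
          linarith
        linarith
  -- concentration at a small scale is excluded
  set σ := √s with hσ
  have hσ2 : σ ^ 2 = s := sq_sqrt hs0.le
  have hσ1 : 1 ≤ σ := one_le_sqrt.2 hs
  have hbP : 0 ≤ b * P₁ ^ 2 := by positivity
  have hG₁σ : G₁ ≤ σ / 10 ^ 4 := (abs_le_of_sq_le_sq' (by
    rw [div_pow, hσ2]; linarith [sq_nonneg P₂, sq_nonneg G₁]) (by positivity)).2
  have hP₂σ : P₂ ≤ σ / 10 ^ 4 := (abs_le_of_sq_le_sq' (by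
    rw [div_pow, hσ2]; linarith [sq_nonneg P₂, sq_nonneg G₁]) (by positivity)).2
  have hYs : 1 / 4 ≤ s * Y := by
    have hQs : 1 / 2 ≤ s * Q := by
      by_contra! hc
      have hQ1 : Q ≤ 1 / 2 := (le_mul_of_one_le_left hQ0 hs).trans hc.le
      have hqG : 1 / 4 ≤ q * G₁ := by linarith
      have hqσ : 1 / 4 ≤ q * σ / 10 ^ 4 := by
        have := mul_le_mul_of_nonneg_left hG₁σ hq
        linarith
      have : (q * σ) ^ 2 = 2 * (s * Q) := by rw [mul_pow, hσ2, hqQ]; ring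
      have h2500 : 2500 ^ 2 ≤ (q * σ) ^ 2 := pow_le_pow_left₀ (by norm_num) (by linarith) 2
      linarith
    have := mul_le_mul_of_nonneg_left hQY hs0.le
    linarith
  -- In the variable `t` all bounds become homogeneous: `q` and `κ` are `O(t²/σ)`, `G₂` is at most a
  -- small multiple of `s(1 + t)`, and `R` a small multiple of `t/s`. Then `t⁴ = sR(2κG₁ + 3)` is
  -- too small for `t ≥ 7/10`.
  obtain ⟨t, ht0, ht4⟩ : ∃ t : ℝ, 0 ≤ t ∧ t ^ 4 = s * Y :=
    ⟨√(√(s * Y)), sqrt_nonneg _, by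
      rw [show √(√(s * Y)) ^ 4 = (√(√(s * Y)) ^ 2) ^ 2 by ring, sq_sqrt (sqrt_nonneg _),
        sq_sqrt (by positivity)]⟩
  have ht : 7 / 10 ≤ t := by
    by_contra! hc
    have : t ^ 4 < (7 / 10) ^ 4 := pow_lt_pow_left₀ hc ht0 (by norm_num)
    norm_num at this
    linarith
  have hqt : q * σ ≤ 2 * t ^ 2 := (abs_le_of_sq_le_sq' (by
    rw [mul_pow, hσ2, hqQ, show (2 * t ^ 2) ^ 2 = 4 * t ^ 4 by ring, ht4]
    linarith [mul_le_mul_of_nonneg_left hQY hs0.le])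
    (by positivity)).2
  have hκt : κ * σ ≤ 50 * t ^ 2 := (abs_le_of_sq_le_sq' (by
    rw [mul_pow, hσ2, hκk, show (50 * t ^ 2) ^ 2 = 2500 * t ^ 4 by ring, ht4, hk]
    have u1 : s * (1 / s) = 1 := by field_simp
    have u2 := mul_le_mul_of_nonneg_left heY hs0.le
    linarith) (by positivity)).2
  have hqG : q * G₁ ≤ 2 * t ^ 2 / 10 ^ 4 := by
    linarith [mul_le_mul_of_nonneg_left hG₁σ hq]
  have hκG : κ * G₁ ≤ 50 * t ^ 2 / 10 ^ 4 := by
    linarith [mul_le_mul_of_nonneg_left hG₁σ hκ]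
  have hσs : σ ≤ s := by rw [← hσ2, sq]; exact le_mul_of_one_le_left (by linarith) hσ1
  have hFP : F + P₂ ≤ s * (2 / 10 ^ 4) := by linarith
  have hG₂s : G₂ ≤ s * (2 / 10 ^ 4 + 3 / 2 * t / 10 ^ 2) := by
    -- The factor `3/2` is chosen because `(3/2)² = 9/4` exceeds the `2` in the bound for `qG₁`.
    by_contra! hc
    have hA : (F + P₂) * G₂ ≤ s * (2 / 10 ^ 4) * G₂ := mul_le_mul_of_nonneg_right hFP hG₂
    have hB : s ^ 2 * (q * G₁) ≤ s ^ 2 * (2 * t ^ 2 / 10 ^ 4) :=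
      mul_le_mul_of_nonneg_left hqG (by positivity)
    have hD : s * (3 / 2 * t / 10 ^ 2) ≤ G₂ - s * (2 / 10 ^ 4) := by linarith
    have hE : (s * (3 / 2 * t / 10 ^ 2)) * (s * (3 / 2 * t / 10 ^ 2))
        ≤ G₂ * (G₂ - s * (2 / 10 ^ 4)) := by
      exact mul_le_mul (by linarith) hD (by positivity) hG₂
    have hst : 0 < s ^ 2 * t ^ 2 := by positivity
    linarith
  have hRs : s * R ≤ t / 50 := by
    have : s * (s * R) ≤ s * (t / 50) := by
      have := mul_le_mul_of_nonneg_left ht hs0.le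
      linarith
    exact le_of_mul_le_mul_left this hs0
  have hfin : t ^ 4 ≤ t / 50 * (t ^ 2 / 100 + 3) := by
    rw [ht4, hY, ← mul_assoc]
    apply mul_le_mul hRs _ (by positivity) (by positivity)
    linarith
  have hfin' : t ^ 3 ≤ 1 / 50 * (t ^ 2 / 100 + 3) := by
    have : t * t ^ 3 ≤ t * (1 / 50 * (t ^ 2 / 100 + 3)) := by linarith
    exact le_of_mul_le_mul_left this (by linarith)
  have h7t : (7 / 10) ^ 2 ≤ t ^ 2 := pow_le_pow_left₀ (by norm_num) ht 2
  have h8t := mul_le_mul_of_nonneg_right ht (sq_nonneg t)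
  linarith

/-! ### Inequalities for `g` and `φ`, and the resolvent bound for `λ ≥ 0` -/

section

variable {g g₁ g₂ φ φ₁ φ₂ : ℝ → ℂ}

/-- Pointwise, `cos² = (1 - sin)(1 + sin) ≤ 2(1 - sin)`. -/
theorem l2Norm_cos_mul_sq_le (hg : IsL2 g) (θ : ℝ) :
    l2Norm (fun y => ((cos (y + θ) : ℝ) : ℂ) * g y) ^ 2
      ≤ 2 * ∫ y, (1 - sin (y + θ)) * ‖g y‖ ^ 2 ∂periodMeasure := by
  have hcg := hg.mul_continuous (contDiff_cos_add θ).continuous (periodic_cos_add θ)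
  have hs := (contDiff_sin_add θ).continuous
  have hi := integrable_weight (a := fun y => 1 - sin (y + θ)) (by fun_prop)
    (integrable_norm_sq hg)
  rw [l2Norm_sq hcg, ← integral_const_mul]
  refine integral_mono (integrable_norm_sq hcg) (hi.const_mul 2) fun y => ?_
  simp only [norm_mul, mul_pow, Complex.norm_real, norm_eq_abs, sq_abs]
  have h1 : cos (y + θ) ^ 2 ≤ 2 * (1 - sin (y + θ)) := by
    nlinarith [sin_sq_add_cos_sq (y + θ)]
  have h2 := mul_le_mul_of_nonneg_right h1 (sq_nonneg ‖g y‖)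
  linarith

theorem l2Norm_multiplier_le {k θ : ℝ} (hk : 0 < k) (hk6 : k ≤ 6) (hg : IsL2 g) (hg₁ : IsL2 g₁) :
    IsL2 (fun y => ((2 * truncCos k θ y : ℝ) : ℂ) * g₁ y
      + ((2 * deriv (truncCos k θ) y + 1 : ℝ) : ℂ) * g y) ∧
    l2Norm (fun y => ((2 * truncCos k θ y : ℝ) : ℂ) * g₁ y
      + ((2 * deriv (truncCos k θ) y + 1 : ℝ) : ℂ) * g y)
      ≤ 2 * √(2 * k) * l2Norm g₁ + 3 * l2Norm g := by
  have ha := contDiff_truncCos (θ := θ) hk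
  have hac := ha.continuous
  have hda : Continuous (deriv (truncCos k θ)) := ha.continuous_deriv (by simp)
  have h1 := hg₁.mul_continuous (a := fun y => 2 * truncCos k θ y) (by fun_prop)
    (fun y => by simp only [periodic_truncCos y])
  have h2 := hg.mul_continuous (a := fun y => 2 * deriv (truncCos k θ) y + 1) (by fun_prop)
    (fun y => by simp only [periodic_deriv periodic_truncCos y])
  refine ⟨h1.add h2, (l2Norm_add_le h1 h2).trans (add_le_add ?_ ?_)⟩
  · refine l2Norm_mul_le (fun y => ?_) hg₁
    rw [abs_mul, abs_two]
    linarith [abs_truncCos_le (θ := θ) hk y]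
  · refine l2Norm_mul_le (fun y => ?_) hg
    rw [abs_le]
    constructor
    · linarith [neg_one_le_deriv_truncCos (θ := θ) hk y]
    · linarith [deriv_truncCos_le (θ := θ) hk hk6 y]

/-- Cauchy–Schwarz on the commutator identity with `a = truncCos k θ`. The `1/8` comes from `1 - a'
≥ 1/8`; the weight `1 + a'` on `|φ|²` is only nonnegative, so that integral is kept as it is. -/
theorem rayleigh_coercive {lam θ b k : ℝ} (hk : 0 < k) (hk6 : k ≤ 6) (hlam : 0 ≤ lam)
    (hek : 3 * max (1 - lam) 0 ≤ k) (hg : HasWeakDeriv g g₁)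
    (hφ : HasWeakDeriv φ φ₁) (hφ₁ : HasWeakDeriv φ₁ φ₂)
    (h : ∀ᵐ y ∂periodMeasure, φ₂ y = g y + b * φ y) :
    (∫ y, (1 - sin (y + θ)) * ‖g y‖ ^ 2 ∂periodMeasure) / 2 + lam * l2Norm φ₁ ^ 2 / 8
        + lam * b * ∫ y, (1 + deriv (truncCos k θ) y) * ‖φ y‖ ^ 2 ∂periodMeasure
      ≤ l2Norm (rayleighExpr lam θ g φ) * (2 * √(2 * k) * l2Norm g₁ + 3 * l2Norm g) := by
  have ha := contDiff_truncCos (θ := θ) hk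
  have hac := ha.continuous
  have hda : Continuous (deriv (truncCos k θ)) := ha.continuous_deriv (by simp)
  obtain ⟨hV, hVle⟩ := l2Norm_multiplier_le (θ := θ) hk hk6 hg.1 hg.2.1
  have hS := isL2_rayleighExpr hg.1 hφ.1 lam θ
  have hcs := (neg_le_abs _).trans (abs_reInner_le hS hV)
  rw [neg_reInner_rayleigh_multiplier ha periodic_truncCos hg hφ hφ₁ h] at hcs
  refine le_trans ?_ (hcs.trans (mul_le_mul_of_nonneg_left hVle (l2Norm_nonneg _)))
  have hs := (contDiff_sin_add θ).continuous
  have hc := (contDiff_cos_add θ).continuous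
  have i0 := integrable_weight (a := fun y => 1 - sin (y + θ)) (by fun_prop)
    (integrable_norm_sq hg.1)
  have i0' := integrable_weight (a := fun y => truncCos k θ y * cos (y + θ)
    + (1 + deriv (truncCos k θ) y) * (lam - sin (y + θ))) (by fun_prop) (integrable_norm_sq hg.1)
  have i1 := integrable_norm_sq hφ.2.1
  have i1' := integrable_weight (a := fun y => 1 - deriv (truncCos k θ) y) (by fun_prop) i1
  have i2 := integrable_weight (a := fun y => 1 + deriv (truncCos k θ) y) (by fun_prop)
    (integrable_norm_sq hφ.1)
  rw [l2Norm_sq hφ.2.1, integral_add (i0'.fun_add (i1'.const_mul lam)) (i2.const_mul (lam * b)),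
    integral_add i0' (i1'.const_mul lam), integral_const_mul, integral_const_mul]
  gcongr ?_ + ?_ + _
  · rw [← integral_div]
    refine integral_mono (i0.div_const 2) i0' fun y => ?_
    have := mul_le_mul_of_nonneg_right (truncCos_coercive (θ := θ) hk
      (max_le (by linarith) zero_le_one) hek (le_max_left _ _) y) (sq_nonneg ‖g y‖)
    simp only
    linarith
  · rw [mul_div_assoc]
    refine mul_le_mul_of_nonneg_left ?_ hlam
    rw [← integral_div]
    refine integral_mono (i1.div_const 8) i1' fun y => ?_
    have := mul_le_mul_of_nonneg_right (deriv_truncCos_le (θ := θ) hk hk6 y) (sq_nonneg ‖φ₁ y‖)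
    simp only
    linarith

theorem l2Norm_resolvent_ge {A lam θ b s : ℝ} {F : ℝ → ℂ} (hs : 1 ≤ s) (hA : |A| = s ^ 2)
    (hlam : 0 ≤ lam) (hb : 0 ≤ b) (hg : HasWeakDeriv g g₁) (hg₁ : HasWeakDeriv g₁ g₂)
    (hφ : HasWeakDeriv φ φ₁) (hφ₁ : HasWeakDeriv φ₁ φ₂)
    (h : ∀ᵐ y ∂periodMeasure, φ₂ y = g y + b * φ y) (hFL : IsL2 F)
    (hF : ∀ᵐ y ∂periodMeasure,
      F y = Complex.I * A * rayleighExpr lam θ g φ y - (g₂ y - φ₂ y)) :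
    s / 10 ^ 8 * l2Norm g ≤ l2Norm F := by
  rcases (l2Norm_nonneg g).eq_or_lt with hN0 | hN
  · rw [← hN0, mul_zero]; exact l2Norm_nonneg F
  have hs0 : 0 < s := by linarith
  have hcosP := periodic_cos_add θ
  have hcosS := contDiff_cos_add θ
  have hsin := (contDiff_sin_add θ).continuous
  set S := rayleighExpr lam θ g φ with hSdef
  have hS : IsL2 S := isL2_rayleighExpr hg.1 hφ.1 lam θ
  set e := max (1 - lam) 0 with he
  set k := 3 * (e + 1 / s) with hk
  have he0 : 0 ≤ e := le_max_right _ _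
  have he1 : e ≤ 1 := max_le (by linarith) zero_le_one
  have h1s : 0 < 1 / s := by positivity
  have h1s' : 1 / s ≤ 1 := by rw [div_le_one hs0]; exact hs
  have hk0 : 0 < k := by positivity
  have hk6 : k ≤ 6 := by linarith
  set Q := ∫ y, (1 - sin (y + θ)) * ‖g y‖ ^ 2 ∂periodMeasure with hQ
  set X := ∫ y, (1 + deriv (truncCos k θ) y) * ‖φ y‖ ^ 2 ∂periodMeasure with hX
  have hQ0 : 0 ≤ Q := integral_nonneg fun y =>
    mul_nonneg (sub_nonneg.2 (sin_le_one _)) (sq_nonneg _)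
  have hX0 : 0 ≤ X := integral_nonneg fun y =>
    mul_nonneg (by linarith [neg_one_le_deriv_truncCos (θ := θ) hk0 y]) (sq_nonneg _)
  set q := √(2 * Q) with hq
  have hqQ : q ^ 2 = 2 * Q := sq_sqrt (by positivity)
  set κ := √(2 * k) with hκ
  have hκk : κ ^ 2 = 2 * k := sq_sqrt (by positivity)
  have hcosg : ∀ G : ℝ → ℂ, IsL2 G → (∀ y, ‖G y‖ = ‖g y‖) →
      l2Norm (fun y => ((cos (y + θ) : ℝ) : ℂ) * G y) ≤ q := by
    intro G hG hGg
    refine le_sqrt_of_sq_le ((l2Norm_cos_mul_sq_le hG θ).trans_eq ?_)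
    simp only [hGg, hQ]
  have e1 : l2Norm g₁ ^ 2 + l2Norm φ₂ ^ 2 + b * l2Norm φ₁ ^ 2 ≤ l2Norm F * l2Norm g := by
    rw [← reInner_resolvent_self hg hg₁ hφ hφ₁ h hF]
    exact (le_abs_self _).trans (abs_reInner_le hFL hg.1)
  have e2 : l2Norm g₂ ^ 2 ≤ (l2Norm F + l2Norm φ₂) * l2Norm g₂ + s ^ 2 * (q * l2Norm g₁) := by
    rw [l2Norm_sq_second_deriv hg hg₁ hφ hφ₁ h hFL hF]
    have hIg := hg.1.const_mul Complex.I
    have t1 := (neg_le_abs _).trans (abs_reInner_le hFL hg₁.2.1)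
    have t2 := (le_abs_self _).trans (abs_reInner_le hφ₁.2.1 hg₁.2.1)
    have t3 := abs_reInner_le (hIg.mul_continuous hcosS.continuous hcosP) hg.2.1
    have t4 := t3.trans (mul_le_mul_of_nonneg_right (hcosg _ hIg fun y => by simp)
      (l2Norm_nonneg g₁))
    have t5 := mul_le_mul_of_nonneg_left t4 (abs_nonneg A)
    rw [← abs_mul, hA] at t5
    have t6 := (neg_le_abs _).trans t5
    linarith
  have e3 : s ^ 2 * l2Norm S ≤ l2Norm F + l2Norm g₂ + l2Norm φ₂ := by
    have t1 : l2Norm (fun y => Complex.I * A * S y)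
        = l2Norm (fun y => (F y + g₂ y) + (-1 : ℂ) * φ₂ y) :=
      l2Norm_congr (by filter_upwards [hF] with y hy; rw [hy]; ring)
    rw [l2Norm_const_mul, norm_mul, Complex.norm_I, one_mul, Complex.norm_real, norm_eq_abs,
      hA] at t1
    rw [t1]
    refine (l2Norm_add_le (hFL.add hg₁.2.1) (hφ₁.2.1.const_mul _)).trans ?_
    rw [l2Norm_const_mul]
    simpa using l2Norm_add_le hFL hg₁.2.1
  have e4 := rayleigh_coercive (θ := θ) hk0 hk6 hlam (by linarith) hg hφ hφ₁ h
  have e5 : l2Norm g ^ 2 ≤ Q + 2 * (q * l2Norm g₁) := by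
    have t1 := integral_neg_deriv_mul_norm_sq hcosS hcosP hg
    simp only [fun y => (hasDerivAt_cos_add θ y).deriv, neg_neg] at t1
    have t2 := (le_abs_self _).trans
      (abs_reInner_le (hg.1.mul_continuous hcosS.continuous hcosP) hg.2.1)
    have t3 := t2.trans (mul_le_mul_of_nonneg_right (hcosg _ hg.1 fun y => rfl)
      (l2Norm_nonneg g₁))
    have i0 := integrable_norm_sq hg.1
    have t4 : Q + ∫ y, sin (y + θ) * ‖g y‖ ^ 2 ∂periodMeasure = l2Norm g ^ 2 := by
      rw [hQ, l2Norm_sq hg.1, ← integral_add (integrable_weight (by fun_prop) i0)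
        (integrable_weight hsin i0)]
      congr 1
      ext y
      ring
    linarith
  have e6 : l2Norm φ ^ 2 ≤ X + 2 * κ * (l2Norm φ * l2Norm φ₁) := by
    have ha := contDiff_truncCos (θ := θ) hk0
    have hda : Continuous (deriv (truncCos k θ)) := ha.continuous_deriv (by simp)
    have t1 := integral_neg_deriv_mul_norm_sq ha periodic_truncCos hφ
    have t2 := (le_abs_self _).trans
      (abs_reInner_le (hφ.1.mul_continuous ha.continuous periodic_truncCos) hφ.2.1)
    have t3 := t2.trans (mul_le_mul_of_nonneg_right
      (l2Norm_mul_le (abs_truncCos_le hk0) hφ.1) (l2Norm_nonneg φ₁))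
    have i0 := integrable_norm_sq hφ.1
    have t4 : X + ∫ y, -deriv (truncCos k θ) y * ‖φ y‖ ^ 2 ∂periodMeasure = l2Norm φ ^ 2 := by
      rw [hX, l2Norm_sq hφ.1, ← integral_add (integrable_weight (by fun_prop) i0)
        (integrable_weight (by fun_prop) i0)]
      congr 1
      ext y
      ring
    linarith
  have e7 := reInner_rayleigh_self (lam := lam) (θ := θ) hg.1 hφ hφ₁ h
  have e7' := abs_reInner_le hS hg.1
  have e8 : b * l2Norm φ ≤ l2Norm g := by
    have t1 := l2Norm_sq_helmholtz hφ hφ₁ hg.1 h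
    refine (abs_le_of_sq_le_sq' ?_ hN.le).2
    rw [t1, mul_pow]
    have : 0 ≤ b * l2Norm φ₁ ^ 2 := by positivity
    linarith [sq_nonneg (l2Norm φ₂)]
  have nn := l2Norm_nonneg
  set N := l2Norm g with hNdef
  have hN' : N ≠ 0 := hN.ne'
  -- Normalize to `‖g‖ = 1`: norms are divided by `N`, quadratic quantities by `N²`.
  have main := le_of_energy_estimates (s := s) (lam := lam) (b := b) (e := e) (k := k)
    (F := l2Norm F / N) (G₁ := l2Norm g₁ / N) (G₂ := l2Norm g₂ / N) (P₀ := l2Norm φ / N)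
    (P₁ := l2Norm φ₁ / N) (P₂ := l2Norm φ₂ / N) (Q := Q / N ^ 2) (X := X / N ^ 2)
    (R := l2Norm S / N) (q := q / N) (κ := κ) (I := reInner S g / N ^ 2)
    hs hlam hb he hk (div_nonneg (nn _) hN.le) (div_nonneg (nn _) hN.le)
    (div_nonneg (nn _) hN.le) (by positivity) (div_nonneg (nn _) hN.le) (by positivity)
    (by rw [div_pow, hqQ]; ring) (by positivity) hκk
    (by rw [← mul_le_mul_iff_left₀ (pow_pos hN 2)]; field_simp; linarith)
    (by rw [← mul_le_mul_iff_left₀ (pow_pos hN 2)]; field_simp; linarith)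
    (by rw [← mul_le_mul_iff_left₀ hN]; field_simp; linarith)
    (by rw [← mul_le_mul_iff_left₀ (pow_pos hN 2)]; field_simp; linarith)
    (by rw [← mul_le_mul_iff_left₀ (pow_pos hN 2)]; field_simp; linarith)
    (by rw [← mul_le_mul_iff_left₀ (pow_pos hN 2)]; field_simp; linarith)
    (by field_simp; linarith)
    (by rw [abs_div, abs_of_pos (pow_pos hN 2), ← mul_le_mul_iff_left₀ (pow_pos hN 2)]
        field_simp; linarith)
    (by rw [← mul_le_mul_iff_left₀ hN]; field_simp; linarith)
  rwa [le_div_iff₀ hN] at main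

end

/-! ### Symmetry in `λ` and the return from `g` to `w` -/

theorem rayleighExpr_neg (lam θ : ℝ) (g φ : ℝ → ℂ) (y : ℝ) :
    rayleighExpr (-lam) (θ + π) g φ y = -rayleighExpr lam θ g φ y := by
  simp only [rayleighExpr, ← add_assoc, sin_add_pi]
  push_cast
  ring

/-- Both norms expand in `‖φ''‖²`, `‖φ'‖²`, `‖φ‖²`. Since `α² - 1 = δα²` with `0 ≤ δ ≤ 1`, the
coefficients for `g` dominate `δ²` times those for `w`. -/
theorem l2Norm_le_of_helmholtz {φ φ₁ φ₂ w g : ℝ → ℂ} {α : ℝ} (hα : 1 < |α|)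
    (hφ : HasWeakDeriv φ φ₁) (hφ₁ : HasWeakDeriv φ₁ φ₂) (hw : IsL2 w) (hg : IsL2 g)
    (h : ∀ᵐ y ∂periodMeasure, φ₂ y = w y + (α ^ 2 : ℝ) * φ y)
    (h' : ∀ᵐ y ∂periodMeasure, φ₂ y = g y + (α ^ 2 - 1 : ℝ) * φ y) :
    (1 - (α ^ 2)⁻¹) * l2Norm w ≤ l2Norm g := by
  have hα2 : 1 < α ^ 2 := by rwa [one_lt_sq_iff_one_lt_abs]
  have hW := l2Norm_sq_helmholtz hφ hφ₁ hw h
  have hG := l2Norm_sq_helmholtz hφ hφ₁ hg h'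
  set δ := 1 - (α ^ 2)⁻¹ with hδ
  have hδ0 : 0 ≤ δ := sub_nonneg.2 (inv_le_one_of_one_le₀ hα2.le)
  have hδ1 : δ ≤ 1 := sub_le_self _ (by positivity)
  have hb : α ^ 2 - 1 = δ * α ^ 2 := by
    rw [hδ, sub_mul, one_mul, inv_mul_cancel₀ (zero_lt_one.trans hα2).ne']
  refine (abs_le_of_sq_le_sq' ?_ (l2Norm_nonneg g)).2
  rw [mul_pow, hW, hG, hb]
  have t1 : δ ^ 2 * l2Norm φ₂ ^ 2 ≤ l2Norm φ₂ ^ 2 :=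
    mul_le_of_le_one_left (sq_nonneg _) (pow_le_one₀ hδ0 hδ1)
  have t2 : δ * (δ * (2 * α ^ 2 * l2Norm φ₁ ^ 2)) ≤ δ * (2 * α ^ 2 * l2Norm φ₁ ^ 2) :=
    mul_le_of_le_one_left (by positivity) hδ1
  linarith

end HelicalFlow

open HelicalFlow

theorem proposition3p1 :
    ∃ C > (0 : ℝ), ∃ K > (0 : ℝ), ∀ ν γ lam α : ℝ,
      0 < ν → ν ≤ 1 → K * ν ^ 2 ≤ |γ| → 1 < |α| →
      ∀ (α₀ : ℝ) (w Lw : ℝ → ℂ), HelicalFlow.IsResolventImage ν γ lam α α₀ w Lw →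
        C * |γ| ^ (1 / 2 : ℝ) * (1 - (α ^ 2)⁻¹) * HelicalFlow.l2Norm w ≤
          HelicalFlow.l2Norm Lw := by
  refine ⟨1 / 10 ^ 8, by norm_num, 1, one_pos, ?_⟩
  rintro ν γ lam α hν - hγ hα α₀ w Lw
    ⟨w₂, φ, ⟨w₁, hw, hw₁⟩, ⟨φ₂, ⟨φ₁, hφ, hφ₁⟩, hstream⟩, hLw, hLweq⟩
  have hα2 : 1 < α ^ 2 := by rwa [one_lt_sq_iff_one_lt_abs]
  have hg := hw.add hφ
  have hg₁ := hw₁.add hφ₁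
  have h : ∀ᵐ y ∂periodMeasure, φ₂ y = (w y + φ y) + ((α ^ 2 - 1 : ℝ) : ℂ) * φ y := by
    filter_upwards [hstream] with y hy
    rw [← hy]
    push_cast
    ring
  have h' : ∀ᵐ y ∂periodMeasure, φ₂ y = w y + ((α ^ 2 : ℝ) : ℂ) * φ y := by
    filter_upwards [hstream] with y hy
    rw [← hy]
    push_cast
    ring
  have hgw := l2Norm_le_of_helmholtz hα hφ hφ₁ hw.1 hg.1 h' h
  have hνC : (ν : ℂ) ≠ 0 := by exact_mod_cast hν.ne'
  have hF : ∀ᵐ y ∂periodMeasure, ((ν⁻¹ : ℝ) : ℂ) * Lw y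
      = Complex.I * ((γ / ν ^ 2 : ℝ) : ℂ) * rayleighExpr lam α₀ (fun y => w y + φ y) φ y
        - ((w₂ y + φ₂ y) - φ₂ y) := by
    filter_upwards [hLweq] with y hy
    rw [hy]
    simp only [resolventExpr, rayleighExpr]
    push_cast
    field_simp
    ring
  have hF' : ∀ᵐ y ∂periodMeasure, ((ν⁻¹ : ℝ) : ℂ) * Lw y
      = Complex.I * ((-(γ / ν ^ 2) : ℝ) : ℂ)
          * rayleighExpr (-lam) (α₀ + π) (fun y => w y + φ y) φ y
        - ((w₂ y + φ₂ y) - φ₂ y) := by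
    filter_upwards [hF] with y hy
    rw [hy, rayleighExpr_neg]
    push_cast
    ring
  -- The choice `K = 1` is exactly what makes `s = √|γ|/ν` at least `1`.
  have hs : 1 ≤ √|γ| / ν := by
    rw [le_div_iff₀ hν, one_mul]
    exact le_sqrt_of_sq_le (by linarith)
  have hA : |γ / ν ^ 2| = (√|γ| / ν) ^ 2 := by
    rw [abs_div, abs_of_pos (pow_pos hν 2), div_pow, sq_sqrt (abs_nonneg γ)]
  have key : √|γ| / ν / 10 ^ 8 * l2Norm (fun y => w y + φ y)
      ≤ l2Norm (fun y => ((ν⁻¹ : ℝ) : ℂ) * Lw y) := by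
    rcases le_total 0 lam with hl | hl
    · exact l2Norm_resolvent_ge hs hA hl (by linarith) hg hg₁ hφ hφ₁ h (hLw.const_mul _) hF
    · exact l2Norm_resolvent_ge hs (by rwa [abs_neg]) (neg_nonneg.2 hl) (by linarith) hg hg₁ hφ hφ₁
        h (hLw.const_mul _) hF'
  rw [l2Norm_const_mul, Complex.norm_real, norm_eq_abs, abs_of_pos (inv_pos.2 hν)] at key
  rw [← sqrt_eq_rpow]
  have hscale := mul_le_mul_of_nonneg_left key hν.le
  have e1 : ν * (ν⁻¹ * l2Norm Lw) = l2Norm Lw := by field_simp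
  have e2 : ν * (√|γ| / ν / 10 ^ 8 * l2Norm (fun y => w y + φ y))
      = 1 / 10 ^ 8 * √|γ| * l2Norm (fun y => w y + φ y) := by field_simp
  rw [e1, e2] at hscale
  refine le_trans ?_ hscale
  rw [mul_assoc]
  exact mul_le_mul_of_nonneg_left hgw (by positivity)
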